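/- Let $H$ be a complex Hilbert space with inner product $(\cdot,\cdot)$. A densely defined linear operator $A$ in $H$ is called maximal symmetric if it is symmetric and has no proper symmetric extension in $H$. A densely defined linear operator $B$ in $H$ is called maximal accretive if $\operatorname{Re}(Bu,u)\ge 0$ for all $u\in\operatorname{dom}B$ and $B$ has no proper extension in $H$ with this property. For a maximal accretive operator $B$, the square root $B^{1/2}$ is the closure of the operator $$u\mapsto \frac1\pi\int_0^\infty t^{-1/2}\,B(B+tI)^{-1}u\,dt,\qquad u\in\operatorname{dom}B,$$ and $B^{*1/2}:=(B^*)^{1/2}$. Theorem. Let $A$ be a maximal symmetric operator in $H$ that is not selfadjoint, and suppose that $i$ belongs to the resolvent set $\rho(A)$. Then the operator $B=iA$ is maximal accretive, and $$\operatorname{dom}B^{1/2}\neq\operatorname{dom}B^{*1/2}.$$ -/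

import Mathlib

noncomputable section

namespace KatoSqrt

open MeasureTheory

variable {H : Type*} [NormedAddCommGroup H] [InnerProductSpace ℂ H]

/-- `A` is symmetric: densely defined with `⟪A x, y⟫ = ⟪x, A y⟫` for all `x, y ∈ dom A`. -/
def IsSymmetric (A : H →ₗ.[ℂ] H) : Prop :=
  Dense (A.domain : Set H) ∧ A.IsFormalAdjoint A

/-- `A` is maximal symmetric: symmetric, without proper symmetric extensions in `H`. -/
def IsMaximalSymmetric (A : H →ₗ.[ℂ] H) : Prop :=
  IsSymmetric A ∧ ∀ S : H →ₗ.[ℂ] H, IsSymmetric S → A ≤ S → S = A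

/-- `B` is accretive: `Re ⟪B u, u⟫ ≥ 0` for all `u ∈ dom B`. -/
def IsAccretive (B : H →ₗ.[ℂ] H) : Prop :=
  ∀ u : B.domain, 0 ≤ (inner ℂ (B u) (u : H)).re

/-- `B` is maximal accretive: densely defined and accretive, without proper accretive
extensions in `H`. -/
def IsMaximalAccretive (B : H →ₗ.[ℂ] H) : Prop :=
  Dense (B.domain : Set H) ∧ IsAccretive B ∧
    ∀ S : H →ₗ.[ℂ] H, IsAccretive S → B ≤ S → S = B

/-- The operator `A - z I : dom A → H`. -/
def shift (A : H →ₗ.[ℂ] H) (z : ℂ) : A.domain →ₗ[ℂ] H :=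
  A.toFun - z • A.domain.subtype

open scoped Classical in
/-- The inverse `(A - z I)⁻¹ : H → dom A` (and `0` if `A - z I` is not a bijection of `dom A`
onto `H`). -/
def resolvent (A : H →ₗ.[ℂ] H) (z : ℂ) : H →ₗ[ℂ] A.domain :=
  if h : Function.Bijective (shift A z) then
    (LinearEquiv.ofBijective (shift A z) h).symm.toLinearMap
  else 0

/-- The resolvent set `ρ(A)`: the `z ∈ ℂ` for which `A - z I` is a bijection of `dom A` onto `H`
with bounded inverse. -/
def resolventSet (A : H →ₗ.[ℂ] H) : Set ℂ :=
  {z | Function.Bijective (shift A z) ∧ Continuous fun x : H => (resolvent A z x : H)}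

/-- The Balakrishnan integrand `t ^ (γ - 1) B (B + t I)⁻¹ u`. -/
def balakrishnanIntegrand (B : H →ₗ.[ℂ] H) (γ : ℝ) (u : H) (t : ℝ) : H :=
  t ^ (γ - 1) • B (resolvent B (-(t : ℂ)) u)

lemma balakrishnanIntegrand_add (B : H →ₗ.[ℂ] H) (γ : ℝ) (u v : H) :
    balakrishnanIntegrand B γ (u + v) =
      balakrishnanIntegrand B γ u + balakrishnanIntegrand B γ v := by
  funext t
  simp [balakrishnanIntegrand, LinearPMap.map_add]

lemma balakrishnanIntegrand_smul (B : H →ₗ.[ℂ] H) (γ : ℝ) (c : ℂ) (u : H) :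
    balakrishnanIntegrand B γ (c • u) = c • balakrishnanIntegrand B γ u := by
  funext t
  simp [balakrishnanIntegrand, LinearPMap.map_smul, smul_comm c]

/-- The Balakrishnan operator `u ↦ (sin (γ π) / π) ∫₀^∞ t ^ (γ - 1) B (B + t I)⁻¹ u dt` on the
vectors `u ∈ dom B` for which the integral converges absolutely. If `B` is maximal accretive and
`0 < γ < 1`, these are all the vectors of `dom B`: the integrand has norm at most
`2 t ^ (γ - 1) ‖u‖` and at most `t ^ (γ - 2) ‖B u‖`. -/
def balakrishnan (B : H →ₗ.[ℂ] H) (γ : ℝ) : H →ₗ.[ℂ] H where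
  domain :=
    { carrier := {u | u ∈ B.domain ∧ IntegrableOn (balakrishnanIntegrand B γ u) (Set.Ioi 0)}
      zero_mem' := by
        refine ⟨B.domain.zero_mem, ?_⟩
        have h : balakrishnanIntegrand B γ 0 = 0 := by
          simpa using balakrishnanIntegrand_smul B γ 0 0
        rw [h]
        exact integrableOn_zero
      add_mem' := by
        rintro u v ⟨hu, hu'⟩ ⟨hv, hv'⟩
        refine ⟨B.domain.add_mem hu hv, ?_⟩
        rw [balakrishnanIntegrand_add]
        exact hu'.add hv'
      smul_mem' := by
        rintro c u ⟨hu, hu'⟩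
        refine ⟨B.domain.smul_mem c hu, ?_⟩
        rw [balakrishnanIntegrand_smul]
        exact hu'.smul c }
  toFun :=
    { toFun := fun u =>
        (Real.sin (γ * Real.pi) / Real.pi) •
          ∫ t in Set.Ioi (0 : ℝ), balakrishnanIntegrand B γ (u : H) t
      map_add' := by
        intro u v
        rw [← smul_add, ← integral_add u.2.2 v.2.2]
        simp only [Submodule.coe_add, balakrishnanIntegrand_add, Pi.add_apply]
      map_smul' := by
        intro c u
        simp only [Submodule.coe_smul, balakrishnanIntegrand_smul, Pi.smul_apply,
          RingHom.id_apply]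
        rw [integral_smul, smul_comm] }

/-- The fractional power `B ^ γ`, `0 < γ < 1`, of a maximal accretive operator `B`: the closure
of the Balakrishnan operator on `dom B`. -/
def fracPow (B : H →ₗ.[ℂ] H) (γ : ℝ) : H →ₗ.[ℂ] H :=
  (balakrishnan B γ).closure

end KatoSqrt

end

open MeasureTheory Filter Topology

namespace KatoSqrt

variable {H : Type*} [NormedAddCommGroup H] [InnerProductSpace ℂ H]

/-! Since `A - i` is onto and `A` is not selfadjoint, there is `e ≠ 0` with `A* e = i e`, that is,
`B* e = e`. As an eigenvector in `dom B*`, `e` lies in `dom B*^(1/2)`.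

It is not in `dom B^(1/2)`. As `-B ⊆ B*`, each `s > 0` gives an eigenvector `g` of `B*` with
eigenvalue `s²`, `‖s g‖ = ‖e‖` and `(g, e) = 2‖e‖² / (1 + s²)` (`exists_adjoint_eigenvector`). The
vectors `s g` tend weakly to `0`: on `dom B`, `(s g, v) = (g, B v) / s`. But if `f = B^(1/2) e`
existed, then `(g, f) = c s (g, e)` with `c > 0` (`inner_fracPow`), so `(s g, f)` would tend to `2 c
‖e‖² ≠ 0`. -/

theorem re_inner_self (x : H) : (inner ℂ x x).re = ‖x‖ ^ 2 := inner_self_eq_norm_sq (𝕜 := ℂ) x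

theorem shift_neg_apply (A : H →ₗ.[ℂ] H) (z : ℂ) (u : A.domain) :
    shift A (-z) u = A u + z • (u : H) := by
  simp [shift]

theorem shift_resolvent {A : H →ₗ.[ℂ] H} {z : ℂ} (h : Function.Bijective (shift A z)) (v : H) :
    shift A z (resolvent A z v) = v := by
  rw [resolvent, dif_pos h]
  exact (LinearEquiv.ofBijective (shift A z) h).apply_symm_apply v

theorem resolvent_eq_of_shift_eq {A : H →ₗ.[ℂ] H} {z : ℂ} (h : Function.Bijective (shift A z))
    {u : A.domain} {v : H} (huv : shift A z u = v) : resolvent A z v = u :=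
  h.1 ((shift_resolvent h v).trans huv.symm)

/-! ### Accretive operators and their resolvents. -/

theorem IsAccretive.mul_norm_sq_le_re_inner {B : H →ₗ.[ℂ] H} (hB : IsAccretive B) (t : ℝ)
    (u : B.domain) : t * ‖(u : H)‖ ^ 2 ≤ (inner ℂ (B u + (t : ℂ) • (u : H)) (u : H)).re := by
  have h := hB u
  rw [inner_add_left, inner_smul_left, Complex.conj_ofReal, Complex.add_re, Complex.re_ofReal_mul,
    re_inner_self]
  linarith

theorem IsAccretive.mul_norm_le {B : H →ₗ.[ℂ] H} (hB : IsAccretive B) (t : ℝ)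
    (u : B.domain) : t * ‖(u : H)‖ ≤ ‖B u + (t : ℂ) • (u : H)‖ := by
  rcases (norm_nonneg (u : H)).eq_or_lt with h0 | h0
  · rw [← h0, mul_zero]; positivity
  · have h1 := hB.mul_norm_sq_le_re_inner t u
    have h2 := (Complex.re_le_norm _).trans (norm_inner_le_norm (𝕜 := ℂ)
      (B u + (t : ℂ) • (u : H)) (u : H))
    nlinarith

theorem IsAccretive.injective_shift {B : H →ₗ.[ℂ] H} (hB : IsAccretive B) {t : ℝ} (ht : 0 < t) :
    Function.Injective (shift B (-(t : ℂ))) := by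
  rw [← LinearMap.ker_eq_bot, LinearMap.ker_eq_bot']
  intro u hu
  have h := hB.mul_norm_le t u
  rw [← shift_neg_apply, hu, norm_zero] at h
  have : ‖(u : H)‖ = 0 := le_antisymm (by nlinarith [norm_nonneg (u : H)]) (norm_nonneg _)
  exact Subtype.ext (norm_eq_zero.1 this)

theorem IsAccretive.exists_bounded_resolvent {B : H →ₗ.[ℂ] H} (hB : IsAccretive B) {t : ℝ}
    (ht : 0 < t) (h : Function.Surjective (shift B (-(t : ℂ)))) :
    ∃ R : H →L[ℂ] H, ∀ v, ∃ u : B.domain, (u : H) = R v ∧ B u + (t : ℂ) • (u : H) = v := by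
  have hb : Function.Bijective (shift B (-(t : ℂ))) := ⟨hB.injective_shift ht, h⟩
  have hr (v : H) : B (resolvent B (-(t : ℂ)) v) + (t : ℂ) • (resolvent B (-(t : ℂ)) v : H) = v := by
    rw [← shift_neg_apply, shift_resolvent hb]
  refine ⟨(B.domain.subtype ∘ₗ resolvent B (-(t : ℂ))).mkContinuous t⁻¹ fun v => ?_, fun v =>
    ⟨resolvent B (-(t : ℂ)) v, rfl, hr v⟩⟩
  have h1 := hB.mul_norm_le t (resolvent B (-(t : ℂ)) v)
  rw [hr] at h1
  rw [inv_mul_eq_div, le_div_iff₀ ht, mul_comm]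
  exact h1

/-- With `R = (B + 1)⁻¹`, `B + t = (1 - (1 - t) R)(B + 1)`. The first factor is coercive with
constant `min 1 t`, because `0 ≤ Re (y, R y) ≤ ‖y‖²`; this reaches every `t > 0` at once. -/
theorem IsAccretive.bijective_shift [CompleteSpace H] {B : H →ₗ.[ℂ] H} (hB : IsAccretive B)
    (h : ∀ v : H, ∃ u : B.domain, B u + (u : H) = v) {t : ℝ} (ht : 0 < t) :
    Function.Bijective (shift B (-(t : ℂ))) := by
  refine ⟨hB.injective_shift ht, fun v => ?_⟩
  obtain ⟨R, hR⟩ := hB.exists_bounded_resolvent one_pos fun v => by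
    obtain ⟨u, hu⟩ := h v
    exact ⟨u, by rw [shift_neg_apply, Complex.ofReal_one, one_smul, hu]⟩
  have hunit : IsUnit (1 - ((1 - t : ℝ) : ℂ) • R) := by
    refine ContinuousLinearMap.isUnit_of_forall_le_norm_inner_map _ (c := ⟨min 1 t, by positivity⟩)
      (show (0 : ℝ) < min 1 t by positivity) fun y => ?_
    refine le_trans ?_ (Complex.re_le_norm _)
    obtain ⟨u, hu, hy⟩ := hR y
    have h1 := hB.mul_norm_sq_le_re_inner 1 u
    have h2 := hB.mul_norm_le 1 u
    have h3 := (Complex.re_le_norm _).trans (norm_inner_le_norm (𝕜 := ℂ) y (u : H))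
    rw [hy] at h1 h2
    have h4 : (inner ℂ (u : H) y).re = (inner ℂ y (u : H)).re := by
      rw [← inner_conj_symm, Complex.conj_re]
    have h5 : (inner ℂ ((1 - ((1 - t : ℝ) : ℂ) • R) y) y).re
        = ‖y‖ ^ 2 - (1 - t) * (inner ℂ y (u : H)).re := by
      simp only [sub_apply, smul_apply,
        one_apply_eq_self]
      rw [inner_sub_left, inner_smul_left, Complex.conj_ofReal, Complex.sub_re,
        Complex.re_ofReal_mul, re_inner_self, ← hu, h4]
    rw [h5]
    change ‖y‖ ^ 2 * min 1 t ≤ _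
    have h6 : 0 ≤ (inner ℂ y (u : H)).re := by nlinarith [sq_nonneg ‖(u : H)‖]
    have h7 : (inner ℂ y (u : H)).re ≤ ‖y‖ ^ 2 := by nlinarith [norm_nonneg y]
    rcases le_total 1 t with h8 | h8
    · rw [min_eq_left h8]; nlinarith
    · rw [min_eq_right h8]; nlinarith
  obtain ⟨y, hy⟩ := ((ContinuousLinearMap.isUnit_iff_bijective).1 hunit).2 v
  obtain ⟨u, hu, huy⟩ := hR y
  refine ⟨u, ?_⟩
  rw [shift_neg_apply, ← hy]
  simp only [sub_apply, smul_apply,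
    one_apply_eq_self, ← hu]
  rw [← huy]
  push_cast
  module

/-- `B + 1` is onto and `S + 1` is injective for every accretive extension `S`, so `S` has no room
for a larger domain. -/
theorem IsAccretive.isMaximalAccretive {B : H →ₗ.[ℂ] H} (hB : IsAccretive B)
    (hd : Dense (B.domain : Set H)) (h : ∀ v : H, ∃ u : B.domain, B u + (u : H) = v) :
    IsMaximalAccretive B := by
  refine ⟨hd, hB, fun S hS hBS => (LinearPMap.eq_of_le_of_domain_eq hBS
    (le_antisymm hBS.1 fun x hx => ?_)).symm⟩
  obtain ⟨u, hu⟩ := h (S ⟨x, hx⟩ + x)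
  have h1 : B u = S ⟨u, hBS.1 u.2⟩ := hBS.2 rfl
  have h2 := hS.injective_shift one_pos (a₁ := ⟨u, hBS.1 u.2⟩) (a₂ := ⟨x, hx⟩) (by
    rw [shift_neg_apply, shift_neg_apply, Complex.ofReal_one, one_smul, one_smul, ← h1, hu])
  rw [← show (u : H) = x from congrArg Subtype.val h2]
  exact u.2

/-- The kernel of `B* + t` is orthogonal to the range of `B + t`, and the adjoint of `(B + t)⁻¹` is
a right inverse of `B* + t`. -/
theorem IsAccretive.bijective_shift_adjoint [CompleteSpace H] {B : H →ₗ.[ℂ] H}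
    (hB : IsAccretive B) (hd : Dense (B.domain : Set H)) {t : ℝ} (ht : 0 < t)
    (h : Function.Surjective (shift B (-(t : ℂ)))) :
    Function.Bijective (shift B.adjoint (-(t : ℂ))) := by
  constructor
  · rw [← LinearMap.ker_eq_bot, LinearMap.ker_eq_bot']
    intro w hw
    obtain ⟨u, hu⟩ := h w
    rw [shift_neg_apply] at hw hu
    have h1 := LinearPMap.adjoint_isFormalAdjoint hd w u
    have h2 : inner ℂ (w : H) (w : H) = 0 := by
      nth_rewrite 2 [← hu]
      rw [inner_add_right, ← h1, inner_smul_right, ← Complex.conj_ofReal, ← inner_smul_left,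
        ← inner_add_left, hw, inner_zero_left]
    exact Subtype.ext (inner_self_eq_zero.1 h2)
  · intro v
    obtain ⟨R, hR⟩ := hB.exists_bounded_resolvent ht h
    have key (u : B.domain) : inner ℂ (v - (t : ℂ) • R.adjoint v) (u : H)
        = inner ℂ (R.adjoint v) (B u) := by
      obtain ⟨u', hu', hu''⟩ := hR (B u + (t : ℂ) • (u : H))
      have : u' = u := hB.injective_shift ht (by rw [shift_neg_apply, shift_neg_apply, hu''])
      subst this
      have h1 : inner ℂ (R.adjoint v) (B u' + (t : ℂ) • (u' : H)) = inner ℂ v (u' : H) := by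
        rw [ContinuousLinearMap.adjoint_inner_left, ← hu']
      rw [inner_sub_left, ← h1, inner_add_right, inner_smul_left, inner_smul_right,
        Complex.conj_ofReal]
      ring
    have hmem : R.adjoint v ∈ B.adjoint.domain :=
      LinearPMap.mem_adjoint_domain_of_exists _ ⟨_, key⟩
    refine ⟨⟨_, hmem⟩, ?_⟩
    rw [shift_neg_apply, LinearPMap.adjoint_apply_eq hd ⟨_, hmem⟩ key]
    simp

/-! ### Fractional powers and eigenvectors. -/

/-- The normalization constant for which `balakrishnan B γ` acts on an eigenvector of eigenvalue
`μ` as multiplication by `fracConst γ * μ ^ γ`. -/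
noncomputable def fracConst (γ : ℝ) : ℝ :=
  Real.sin (γ * Real.pi) / Real.pi * ∫ t in Set.Ioi (0 : ℝ), Real.rpowIntegrand₀₁ γ t 1

/-- The value is `1` by Euler's integral, but its sign suffices. -/
theorem fracConst_pos {γ : ℝ} (hγ : γ ∈ Set.Ioo (0 : ℝ) 1) : 0 < fracConst γ := by
  have h : 0 < Real.sin (γ * Real.pi) :=
    Real.sin_pos_of_pos_of_lt_pi (mul_pos hγ.1 Real.pi_pos)
      (by nlinarith [Real.pi_pos, hγ.2])
  exact mul_pos (div_pos h Real.pi_pos) (Real.integral_rpowIntegrand₀₁_one_pos hγ)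

theorem mem_domain_fracPow_of_eigenvector {B : H →ₗ.[ℂ] H} {γ μ : ℝ}
    (hγ : γ ∈ Set.Ioo (0 : ℝ) 1) (hμ : 0 ≤ μ)
    (hB : ∀ t : ℝ, 0 < t → Function.Bijective (shift B (-(t : ℂ))))
    (e : B.domain) (he : B e = (μ : ℂ) • (e : H)) :
    (e : H) ∈ (fracPow B γ).domain := by
  refine (LinearPMap.le_closure (balakrishnan B γ)).1 ⟨e.2, ?_⟩
  refine IntegrableOn.congr_fun
    ((Real.integrableOn_rpowIntegrand₀₁_Ioi hγ hμ).smul_const (e : H))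
    (fun t ht => ?_) measurableSet_Ioi
  have ht : 0 < t := ht
  have hne : (t : ℂ) + μ ≠ 0 := by exact_mod_cast (add_pos_of_pos_of_nonneg ht hμ).ne'
  have hr : resolvent B (-(t : ℂ)) (e : H) = ((t : ℂ) + μ)⁻¹ • e := by
    refine resolvent_eq_of_shift_eq (hB t ht) ?_
    rw [shift_neg_apply, LinearPMap.map_smul, he, Submodule.coe_smul, smul_comm (t : ℂ),
      ← smul_add, ← add_smul, add_comm (μ : ℂ), inv_smul_smul₀ hne]
  rw [balakrishnanIntegrand, hr, LinearPMap.map_smul, he,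
    Real.rpowIntegrand₀₁_eq_pow_div hγ ht.le hμ, ← Complex.coe_smul, ← Complex.coe_smul, smul_smul, smul_smul]
  congr 1
  push_cast
  ring

variable [CompleteSpace H]

/-- For `w = (B + t)⁻¹ u`, `B* g = μ g` gives `(g, B w) = μ (g, w)` and `(g, u) = (t + μ) (g, w)`,
so pairing with `g` makes the integrand scalar. -/
theorem inner_balakrishnan {B : H →ₗ.[ℂ] H} {γ μ : ℝ} (hγ : γ ∈ Set.Ioo (0 : ℝ) 1) (hμ : 0 ≤ μ)
    (hd : Dense (B.domain : Set H))
    (hB : ∀ t : ℝ, 0 < t → Function.Bijective (shift B (-(t : ℂ))))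
    (g : B.adjoint.domain) (hg : B.adjoint g = (μ : ℂ) • (g : H)) (u : (balakrishnan B γ).domain) :
    inner ℂ (g : H) (balakrishnan B γ u) =
      ((fracConst γ * μ ^ γ : ℝ) : ℂ) * inner ℂ (g : H) (u : H) := by
  have hpt : ∀ t ∈ Set.Ioi (0 : ℝ), inner ℂ (g : H) (balakrishnanIntegrand B γ (u : H) t) =
      (Real.rpowIntegrand₀₁ γ t μ : ℂ) * inner ℂ (g : H) (u : H) := by
    intro t ht
    have ht : 0 < t := ht
    have hne : (t : ℂ) + μ ≠ 0 := by exact_mod_cast (add_pos_of_pos_of_nonneg ht hμ).ne'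
    have hw := shift_resolvent (hB t ht) (u : H)
    rw [shift_neg_apply] at hw
    set w := resolvent B (-(t : ℂ)) (u : H) with hw'
    have h1 := LinearPMap.adjoint_isFormalAdjoint hd g w
    rw [hg, inner_smul_left, Complex.conj_ofReal] at h1
    have h2 : inner ℂ (g : H) (u : H) = ((t : ℂ) + μ) * inner ℂ (g : H) (w : H) := by
      rw [← hw, inner_add_right, ← h1, inner_smul_right]
      ring
    rw [balakrishnanIntegrand, ← hw', ← Complex.coe_smul, inner_smul_right, ← h1, h2,
      Real.rpowIntegrand₀₁_eq_pow_div hγ ht.le hμ]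
    push_cast
    field_simp
  have hint : inner ℂ (g : H) (∫ t in Set.Ioi (0 : ℝ), balakrishnanIntegrand B γ (u : H) t) =
      ((∫ t in Set.Ioi (0 : ℝ), Real.rpowIntegrand₀₁ γ t μ : ℝ) : ℂ) * inner ℂ (g : H) (u : H) := by
    rw [← integral_inner u.2.2, setIntegral_congr_fun measurableSet_Ioi hpt, integral_mul_const,
      integral_complex_ofReal]
  change inner ℂ (g : H) ((Real.sin (γ * Real.pi) / Real.pi) •
    ∫ t in Set.Ioi (0 : ℝ), balakrishnanIntegrand B γ (u : H) t) = _
  rw [← Complex.coe_smul, inner_smul_right, hint,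
    Real.integral_rpowIntegrand₀₁_eq_rpow_mul_const hγ hμ, fracConst]
  push_cast
  ring

theorem inner_fracPow {B : H →ₗ.[ℂ] H} {γ μ : ℝ} (hγ : γ ∈ Set.Ioo (0 : ℝ) 1) (hμ : 0 ≤ μ)
    (hd : Dense (B.domain : Set H))
    (hB : ∀ t : ℝ, 0 < t → Function.Bijective (shift B (-(t : ℂ))))
    (g : B.adjoint.domain) (hg : B.adjoint g = (μ : ℂ) • (g : H)) (u : (fracPow B γ).domain) :
    inner ℂ (g : H) (fracPow B γ u) =
      ((fracConst γ * μ ^ γ : ℝ) : ℂ) * inner ℂ (g : H) (u : H) := by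
  by_cases hc : (balakrishnan B γ).IsClosable
  · have hmem : ((u : H), fracPow B γ u) ∈ (balakrishnan B γ).graph.topologicalClosure := by
      rw [hc.graph_closure_eq_closure_graph]
      exact LinearPMap.mem_graph _ u
    have hcl : IsClosed {p : H × H | inner ℂ (g : H) p.2 =
        ((fracConst γ * μ ^ γ : ℝ) : ℂ) * inner ℂ (g : H) p.1} :=
      isClosed_eq (by fun_prop) (by fun_prop)
    refine closure_minimal (fun p hp => ?_) hcl hmem
    obtain ⟨v, hv1, hv2⟩ := (LinearPMap.mem_graph_iff _).1 hp
    rw [Set.mem_ofPred_eq, ← hv1, ← hv2]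
    exact inner_balakrishnan hγ hμ hd hB g hg v
  -- For a non-closable operator, `closure` returns the operator itself.
  · have key : ∀ T : H →ₗ.[ℂ] H, T = balakrishnan B γ → ∀ u : T.domain,
        inner ℂ (g : H) (T u) = ((fracConst γ * μ ^ γ : ℝ) : ℂ) * inner ℂ (g : H) (u : H) := by
      rintro _ rfl u
      exact inner_balakrishnan hγ hμ hd hB g hg u
    exact key _ (LinearPMap.closure_def' hc) u

/-! ### Eigenvectors of the adjoint of a skew-symmetric operator. -/

/-- Take `g = e + h` with `(B + μ) h = (1 - μ) e`. By skew-symmetry `B* h = -B h`, so `B* g = e - B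
h = μ g`. Pairing `e` and `g` with `B h` yields the two scalar identities. -/
theorem exists_adjoint_eigenvector {B : H →ₗ.[ℂ] H} (hd : Dense (B.domain : Set H))
    (hskew : ∀ u v : B.domain, inner ℂ (B u) (v : H) = -inner ℂ (u : H) (B v))
    (e : B.adjoint.domain) (he : B.adjoint e = (e : H)) {μ : ℝ} (hμ : 0 < μ)
    (hB : Function.Bijective (shift B (-(μ : ℂ)))) :
    ∃ g : B.adjoint.domain, B.adjoint g = (μ : ℂ) • (g : H) ∧
      inner ℂ (g : H) (e : H) = ((2 / (1 + μ) * ‖(e : H)‖ ^ 2 : ℝ) : ℂ) ∧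
      μ * ‖(g : H)‖ ^ 2 = ‖(e : H)‖ ^ 2 := by
  obtain ⟨h, hh⟩ := hB.2 ((1 - (μ : ℂ)) • (e : H))
  rw [shift_neg_apply] at hh
  have hmul : ((1 : ℂ) + μ) ≠ 0 := by exact_mod_cast (add_pos one_pos hμ).ne'
  have hform := LinearPMap.adjoint_isFormalAdjoint hd
  have hBh : B h = (1 - (μ : ℂ)) • (e : H) - (μ : ℂ) • (h : H) := eq_sub_of_add_eq hh
  have key (v : B.domain) :
      inner ℂ ((μ : ℂ) • ((e : H) + h)) (v : H) = inner ℂ ((e : H) + h) (B v) := by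
    have h1 := hform e v
    rw [he] at h1
    have h2 := hskew h v
    rw [hBh] at h2
    rw [inner_add_left, ← h1, ← neg_neg (inner ℂ (h : H) (B v)), ← h2]
    simp only [inner_add_left, inner_sub_left, inner_smul_left, map_sub, map_one,
      Complex.conj_ofReal]
    ring
  have hmem : (e : H) + h ∈ B.adjoint.domain := LinearPMap.mem_adjoint_domain_of_exists _ ⟨_, key⟩
  have hge : B.adjoint ⟨_, hmem⟩ = (μ : ℂ) • ((e : H) + h) :=
    LinearPMap.adjoint_apply_eq hd ⟨_, hmem⟩ key
  have hee : inner ℂ (e : H) (e : H) = ((‖(e : H)‖ ^ 2 : ℝ) : ℂ) := by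
    rw [inner_self_eq_norm_sq_to_K]; push_cast; rfl
  have heh : (1 + (μ : ℂ)) * inner ℂ (e : H) (h : H) = (1 - (μ : ℂ)) * inner ℂ (e : H) (e : H) := by
    have h1 := hform e h
    rw [he, hBh, inner_sub_right, inner_smul_right, inner_smul_right] at h1
    linear_combination h1
  have heg : inner ℂ (e : H) ((e : H) + h) = ((2 / (1 + μ) * ‖(e : H)‖ ^ 2 : ℝ) : ℂ) := by
    have : (1 + (μ : ℂ)) * inner ℂ (e : H) ((e : H) + h) = 2 * inner ℂ (e : H) (e : H) := by
      rw [inner_add_right]; linear_combination heh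
    rw [hee] at this
    refine mul_left_cancel₀ hmul (this.trans ?_)
    push_cast
    field_simp
  have hge' : inner ℂ ((e : H) + h) (e : H) = ((2 / (1 + μ) * ‖(e : H)‖ ^ 2 : ℝ) : ℂ) := by
    rw [← inner_conj_symm, heg, Complex.conj_ofReal]
  refine ⟨⟨_, hmem⟩, hge, hge', ?_⟩
  have hgh : 2 * (μ : ℂ) * inner ℂ ((e : H) + h) (h : H) =
      (1 - (μ : ℂ)) * inner ℂ ((e : H) + h) (e : H) := by
    have h1 := hform ⟨_, hmem⟩ h
    rw [hge, hBh, inner_sub_right, inner_smul_right, inner_smul_right, inner_smul_left,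
      Complex.conj_ofReal] at h1
    linear_combination h1
  have hgg : 2 * (μ : ℂ) * inner ℂ ((e : H) + h) ((e : H) + h) =
      (1 + (μ : ℂ)) * inner ℂ ((e : H) + h) (e : H) := by
    rw [inner_add_right]; linear_combination hgh
  have hn : inner ℂ ((e : H) + h) ((e : H) + h) = ((‖(e : H) + h‖ ^ 2 : ℝ) : ℂ) := by
    rw [inner_self_eq_norm_sq_to_K]; push_cast; rfl
  rw [hge', hn] at hgg
  have hgg' : 2 * μ * ‖(e : H) + h‖ ^ 2 = (1 + μ) * (2 / (1 + μ) * ‖(e : H)‖ ^ 2) := by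
    exact_mod_cast hgg
  have : (1 + μ) * (2 / (1 + μ) * ‖(e : H)‖ ^ 2) = 2 * ‖(e : H)‖ ^ 2 := by
    field_simp
  change μ * ‖(e : H) + h‖ ^ 2 = _
  linarith

theorem notMem_domain_fracPow_half {B : H →ₗ.[ℂ] H} (hd : Dense (B.domain : Set H))
    (hskew : ∀ u v : B.domain, inner ℂ (B u) (v : H) = -inner ℂ (u : H) (B v))
    (hB : ∀ t : ℝ, 0 < t → Function.Bijective (shift B (-(t : ℂ))))
    (e : B.adjoint.domain) (he : B.adjoint e = (e : H)) (hne : (e : H) ≠ 0) :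
    (e : H) ∉ (fracPow B (1 / 2)).domain := by
  intro hmem
  have hγ : (1 / 2 : ℝ) ∈ Set.Ioo (0 : ℝ) 1 := by norm_num
  have hc := fracConst_pos hγ
  have hn : 0 < ‖(e : H)‖ := norm_pos_iff.2 hne
  set c := fracConst (1 / 2)
  set f := fracPow B (1 / 2) ⟨_, hmem⟩ with hf
  -- This is `(s g, f)` split at `v`; `1 ≤ s` ensures `2 s² / (1 + s²) ≥ 1`.
  have key (s : ℝ) (hs : 1 ≤ s) (v : B.domain) :
      c * ‖(e : H)‖ ≤ ‖f - v‖ + ‖B v‖ / s := by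
    have hs0 : 0 < s := by linarith
    have hs2 : 0 < s ^ 2 := by positivity
    obtain ⟨g, hg, hge, hgn⟩ := exists_adjoint_eigenvector hd hskew e he hs2 (hB _ hs2)
    have hpow : (s ^ 2 : ℝ) ^ (1 / 2 : ℝ) = s := by
      rw [← Real.sqrt_eq_rpow, Real.sqrt_sq hs0.le]
    have hgn' : s * ‖(g : H)‖ = ‖(e : H)‖ := by
      rw [← mul_pow] at hgn
      exact (pow_left_inj₀ (by positivity) (by positivity) two_ne_zero).1 hgn
    have h1 := inner_fracPow hγ hs2.le hd hB g hg ⟨_, hmem⟩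
    rw [← hf, hge, hpow, ← Complex.ofReal_mul] at h1
    have h2 : ‖inner ℂ (g : H) f‖ = c * s * (2 / (1 + s ^ 2) * ‖(e : H)‖ ^ 2) := by
      rw [h1, Complex.norm_real, Real.norm_of_nonneg (by positivity)]
    have h3 := LinearPMap.adjoint_isFormalAdjoint hd g v
    rw [hg, inner_smul_left, Complex.conj_ofReal] at h3
    have h4 : s ^ 2 * ‖inner ℂ (g : H) (v : H)‖ ≤ ‖(g : H)‖ * ‖B v‖ := by
      have := norm_inner_le_norm (𝕜 := ℂ) (g : H) (B v)
      rwa [← h3, norm_mul, Complex.norm_real, Real.norm_of_nonneg hs2.le] at this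
    have h5 : ‖inner ℂ (g : H) f‖ ≤ ‖(g : H)‖ * ‖f - v‖ + ‖inner ℂ (g : H) (v : H)‖ := by
      have h6 : inner ℂ (g : H) f = inner ℂ (g : H) (f - v) + inner ℂ (g : H) (v : H) := by
        rw [← inner_add_right, sub_add_cancel]
      rw [h6]
      exact (norm_add_le _ _).trans (by gcongr; exact norm_inner_le_norm _ _)
    have h7 : c * ‖(e : H)‖ ^ 2 ≤ s * ‖inner ℂ (g : H) f‖ := by
      rw [h2]
      have h8 : s * (c * s * (2 / (1 + s ^ 2) * ‖(e : H)‖ ^ 2)) =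
          c * ‖(e : H)‖ ^ 2 * (2 * s ^ 2 / (1 + s ^ 2)) := by
        field_simp
      rw [h8]
      refine le_mul_of_one_le_right (by positivity) ?_
      rw [le_div_iff₀ (by positivity)]
      nlinarith
    have h9 : s * ‖inner ℂ (g : H) (v : H)‖ ≤ ‖(e : H)‖ * (‖B v‖ / s) := by
      rw [← mul_div_assoc, le_div_iff₀ hs0, ← hgn']
      nlinarith [norm_nonneg (B v), mul_nonneg (norm_nonneg (g : H)) (norm_nonneg (B v))]
    have h10 : ‖(e : H)‖ * (c * ‖(e : H)‖) ≤ ‖(e : H)‖ * (‖f - v‖ + ‖B v‖ / s) := by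
      calc ‖(e : H)‖ * (c * ‖(e : H)‖) = c * ‖(e : H)‖ ^ 2 := by ring
        _ ≤ s * ‖inner ℂ (g : H) f‖ := h7
        _ ≤ s * (‖(g : H)‖ * ‖f - v‖ + ‖inner ℂ (g : H) (v : H)‖) := by gcongr
        _ = ‖(e : H)‖ * ‖f - v‖ + s * ‖inner ℂ (g : H) (v : H)‖ := by rw [← hgn']; ring
        _ ≤ _ := by rw [mul_add]; gcongr
    exact le_of_mul_le_mul_left h10 hn
  have hpos : 0 < c * ‖(e : H)‖ := mul_pos hc hn
  obtain ⟨v, hv, hfv⟩ := hd.exists_dist_lt f (half_pos hpos)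
  have hlim : Tendsto (fun s : ℝ => ‖f - v‖ + ‖B ⟨v, hv⟩‖ / s) atTop (𝓝 (‖f - v‖ + 0)) :=
    tendsto_const_nhds.add (tendsto_const_nhds.div_atTop tendsto_id)
  have := ge_of_tendsto hlim (eventually_atTop.2 ⟨1, fun s hs => key s hs ⟨v, hv⟩⟩)
  rw [dist_eq_norm] at hfv
  linarith

/-! ### Selfadjointness and the main theorem. -/

/-- For `y ∈ dom A*`, solve `(A - z) x = (A* - z) y`; then `y - x ∈ ker (A* - z) = 0`, so `y ∈ dom
A`. -/
theorem isSelfAdjoint_of_forall_adjoint_eigenvector_eq_zero {A : H →ₗ.[ℂ] H} (hA : IsSymmetric A)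
    {z : ℂ} (hz : Function.Surjective (shift A z))
    (h : ∀ y : A.adjoint.domain, A.adjoint y = z • (y : H) → (y : H) = 0) : IsSelfAdjoint A := by
  have hle : A ≤ A.adjoint := LinearPMap.IsFormalAdjoint.le_adjoint hA.1 hA.2
  refine LinearPMap.isSelfAdjoint_def.2
    (LinearPMap.eq_of_le_of_domain_eq hle (le_antisymm hle.1 fun y hy => ?_)).symm
  obtain ⟨x, hx⟩ := hz (shift A.adjoint z ⟨y, hy⟩)
  have hx' : A.adjoint ⟨x, hle.1 x.2⟩ = A x := (hle.2 rfl).symm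
  have h0 := h (⟨y, hy⟩ - ⟨x, hle.1 x.2⟩) (by
    simp only [shift, LinearMap.sub_apply, LinearMap.smul_apply, Submodule.subtype_apply,
      LinearPMap.toFun_eq_coe] at hx
    rw [LinearPMap.map_sub, hx', Submodule.coe_sub, smul_sub]
    exact sub_eq_sub_iff_sub_eq_sub.1 hx.symm)
  rw [Submodule.coe_sub, sub_eq_zero] at h0
  change y = (x : H) at h0
  exact h0 ▸ x.2

end KatoSqrt

theorem mainTheorem2 {H : Type*} [NormedAddCommGroup H] [InnerProductSpace ℂ H]
    [CompleteSpace H] (A : H →ₗ.[ℂ] H)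
    (hmax : KatoSqrt.IsMaximalSymmetric A) (hsa : ¬ IsSelfAdjoint A)
    (hres : Complex.I ∈ KatoSqrt.resolventSet A) :
    KatoSqrt.IsMaximalAccretive (Complex.I • A) ∧
      (KatoSqrt.fracPow (Complex.I • A) (1 / 2)).domain ≠
        (KatoSqrt.fracPow (Complex.I • A).adjoint (1 / 2)).domain := by
  obtain ⟨⟨hd, hsymm⟩, -⟩ := hmax
  have hskew : ∀ u v : (Complex.I • A).domain,
      inner ℂ ((Complex.I • A) u) (v : H) = -inner ℂ (u : H) ((Complex.I • A) v) := by
    intro u v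
    rw [LinearPMap.smul_apply, LinearPMap.smul_apply, inner_smul_left, inner_smul_right,
      Complex.conj_I, hsymm u v]
    ring
  have hacc : KatoSqrt.IsAccretive (Complex.I • A) := by
    intro u
    have h := congrArg Complex.re (hskew u u)
    rw [← inner_conj_symm (u : H), Complex.neg_re, Complex.conj_re] at h
    linarith
  have hsurj : ∀ v : H, ∃ u : (Complex.I • A).domain, (Complex.I • A) u + (u : H) = v := by
    intro v
    -- `iA + 1 = i (A - i)`.
    obtain ⟨u, hu⟩ := hres.1.2 (-Complex.I • v)
    refine ⟨u, ?_⟩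
    have h : A u - Complex.I • (u : H) = -Complex.I • v := hu
    have h2 := congrArg (Complex.I • ·) h
    simpa [smul_sub, smul_smul] using h2
  have hbij := fun (t : ℝ) (ht : 0 < t) => hacc.bijective_shift hsurj ht
  refine ⟨hacc.isMaximalAccretive hd hsurj, fun heq => hsa ?_⟩
  refine KatoSqrt.isSelfAdjoint_of_forall_adjoint_eigenvector_eq_zero ⟨hd, hsymm⟩ hres.1.2
    fun y hy => ?_
  by_contra hne
  have key : ∀ v : (Complex.I • A).domain,
      inner ℂ (y : H) (v : H) = inner ℂ (y : H) ((Complex.I • A) v) := by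
    intro v
    have h := LinearPMap.adjoint_isFormalAdjoint hd y v
    rw [hy, inner_smul_left, Complex.conj_I] at h
    rw [LinearPMap.smul_apply, inner_smul_right, ← h, ← mul_assoc, mul_neg, Complex.I_mul_I,
      neg_neg, one_mul]
  have hmem : (y : H) ∈ (Complex.I • A).adjoint.domain :=
    LinearPMap.mem_adjoint_domain_of_exists _ ⟨_, key⟩
  have he : (Complex.I • A).adjoint ⟨y, hmem⟩ = (y : H) :=
    LinearPMap.adjoint_apply_eq (T := Complex.I • A) hd ⟨_, hmem⟩ key
  refine KatoSqrt.notMem_domain_fracPow_half (B := Complex.I • A) hd hskew hbij ⟨y, hmem⟩ he hne ?_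
  rw [heq]
  refine KatoSqrt.mem_domain_fracPow_of_eigenvector (μ := 1) (by norm_num) zero_le_one
    (fun t ht => hacc.bijective_shift_adjoint hd ht (hbij t ht).2) ⟨y, hmem⟩ ?_
  rw [he, Complex.ofReal_one, one_smul]
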